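/- Let $\Omega\subset\mathbb R^N$ be a bounded domain (nonempty, open, connected) with Lipschitz boundary, and let $K:\mathbb R^N\setminus\{0\}\to(0,\infty)$ satisfy: (i) $mK\in L^1(\mathbb R^N)$, where $m(x)=\min\{|x|^2,1\}$; (ii) there are $\alpha>0$ and $s\in(0,1)$ with $N>2s$ such that $K(x)\ge\alpha|x|^{-(N+2s)}$ for all $x\ne0$; (iii) $K(-x)=K(x)$ for all $x\neq 0$. Let $$X_K(\Omega)=\Big\{u\in L^2(\mathbb R^N):\ [u]_K^2:=\int_{\mathbb R^{2N}}(u(x)-u(y))^2K(x-y)\,dx\,dy<\infty,\ u=0\text{ a.e. in }\mathbb R^N\setminus\Omega\Big\},$$ with the scalar product $\langle u,v\rangle=\int_{\mathbb R^{2N}}(u(x)-u(y))(v(x)-v(y))K(x-y)\,dx\,dy$ and the norm $\|u\|=[u]_K$. For $\rho\in L^\infty(\Omega)\setminus\{0\}$, an eigenfunction with eigenvalue $\lambda\in\mathbb R$ is a $u\in X_K(\Omega)\setminus\{0\}$ such that $\langle u,v\rangle=\lambda\int_\Omega\rho uv\,dx$ for all $v\in X_K(\Omega)$. The weight $\rho$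 satisfies the unique continuation property (u.c.p.) if $|\{x\in\Omega:u(x)=0\}|=0$ for every eigenfunction $u$ (with any eigenvalue). For an integer $k>0$ let $\mathcal F_k$ be the set of the $k$-dimensional linear subspaces of $X_K(\Omega)$, and define $$\lambda_k(\rho)^{-1}=\sup_{F\in\mathcal F_k}\ \inf_{u\in F,\,\|u\|=1}\int_\Omega\rho u^2\,dx\quad\text{if }\rho^+\not\equiv0,\qquad \lambda_{-k}(\rho)^{-1}=\inf_{F\in\mathcal F_k}\ \sup_{u\in F,\,\|u\|=1}\int_\Omega\rho u^2\,dx\quad\text{if }\rho^-\not\equiv0.$$ An index $k\in\mathbb Z\setminus\{0\}$ is admissible for $\rho$ if $k>0$ and $\rho^+\not\equiv0$, or $k<0$ and $\rho^-\not\equiv0$. Inequalities and identities between functions are meant almost everywhere in $\Omega$. **Theorem.** If $\rho\in L^\infty(\Omega)\setminus\{0\}$ does not satisfy u.c.p., then there exist $\tilde\rho\in L^\infty(\Omega)\setminus\{0\}$ with $\rho\le\tilde\rho$ or $\rho\ge\tilde\rho$, and $\rho\not\equiv\tilde\rho$, and an index $k\in\mathbb Z\setminus\{0\}$, admissible for both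 $\rho$ and $\tilde\rho$, such that $\lambda_k(\rho)=\lambda_k(\tilde\rho)$. -/

import Mathlib

open MeasureTheory Set
open scoped ENNReal NNReal Topology

noncomputable section

namespace NonlocalEig

/-- `ℝ^N` with its Euclidean norm. -/
abbrev Space (N : ℕ) : Type := EuclideanSpace ℝ (Fin N)

/-- Near every boundary point, `Ω` is the set of points lying strictly above the graph of a
Lipschitz function, in the direction of some unit vector `e`; the function is evaluated at the
orthogonal projection `y - ⟪e, y⟫ e` of `y` onto the hyperplane orthogonal to `e`. -/
def HasLipschitzBoundary {N : ℕ} (Ω : Set (Space N)) : Prop :=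
  ∀ x₀ ∈ frontier Ω, ∃ e : Space N, ‖e‖ = 1 ∧ ∃ (C : ℝ≥0) (φ : Space N → ℝ),
    LipschitzWith C φ ∧ ∃ U ∈ 𝓝 x₀, ∀ y ∈ U,
      (y ∈ Ω ↔ φ (y - inner ℝ e y • e) < inner ℝ e y)

/-- Bounded domain (nonempty, open, connected) with Lipschitz boundary. -/
structure IsLipschitzDomain {N : ℕ} (Ω : Set (Space N)) : Prop where
  isOpen : IsOpen Ω
  isConnected : IsConnected Ω
  isBounded : Bornology.IsBounded Ω
  lipschitz : HasLipschitzBoundary Ω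

/-- The hypotheses on the kernel `K : ℝ^N ∖ {0} → (0, ∞)`; the value `K 0` plays no role. -/
structure IsKernel {N : ℕ} (K : Space N → ℝ) : Prop where
  pos : ∀ x, x ≠ 0 → 0 < K x
  integrable : Integrable (fun x => min (‖x‖ ^ 2) 1 * K x) volume
  lower_bound : ∃ α s : ℝ, 0 < α ∧ 0 < s ∧ s < 1 ∧ 2 * s < (N : ℝ) ∧
    ∀ x, x ≠ 0 → α * ‖x‖ ^ (-((N : ℝ) + 2 * s)) ≤ K x
  symm : ∀ x, x ≠ 0 → K (-x) = K x

/-- The integrand `(u(x) - u(y)) (v(x) - v(y)) K(x - y)` on `ℝ^N × ℝ^N`. -/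
def energyDensity {N : ℕ} (K : Space N → ℝ) (u v : Space N → ℝ) (p : Space N × Space N) : ℝ :=
  (u p.1 - u p.2) * (v p.1 - v p.2) * K (p.1 - p.2)

/-- `[u]_K < ∞`. (For a measurable `u` the density `(u(x) - u(y))² K(x - y)` is measurable and
nonnegative, so that its integral is finite exactly when it is integrable.) -/
def FiniteEnergy {N : ℕ} (K : Space N → ℝ) (u : Space N → ℝ) : Prop :=
  Integrable (energyDensity K u u) (volume : Measure (Space N × Space N))

theorem energyDensity_congr {N : ℕ} (K : Space N → ℝ) {u u' v v' : Space N → ℝ}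
    (hu : u =ᵐ[volume] u') (hv : v =ᵐ[volume] v') :
    energyDensity K u v =ᵐ[(volume : Measure (Space N × Space N))] energyDensity K u' v' := by
  have q1 : Measure.QuasiMeasurePreserving (Prod.fst : Space N × Space N → Space N)
      volume volume := Measure.quasiMeasurePreserving_fst
  have q2 : Measure.QuasiMeasurePreserving (Prod.snd : Space N × Space N → Space N)
      volume volume := Measure.quasiMeasurePreserving_snd
  filter_upwards [q1.ae_eq_comp hu, q2.ae_eq_comp hu, q1.ae_eq_comp hv, q2.ae_eq_comp hv]
    with p h1 h2 h3 h4
  simp only [Function.comp_apply] at h1 h2 h3 h4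
  simp only [energyDensity, h1, h2, h3, h4]

theorem FiniteEnergy.congr {N : ℕ} {K : Space N → ℝ} {u v : Space N → ℝ}
    (hu : FiniteEnergy K u) (h : u =ᵐ[volume] v) : FiniteEnergy K v :=
  Integrable.congr hu (energyDensity_congr K h h)

theorem kernel_aestronglyMeasurable {N : ℕ} {K : Space N → ℝ} (hK : IsKernel K) :
    AEStronglyMeasurable K volume := by
  obtain ⟨_, s, _, hs, _, hN, _⟩ := hK.lower_bound
  have hN0 : 0 < N := by
    have : (0 : ℝ) < N := by linarith
    exact_mod_cast this
  have : Nonempty (Fin N) := ⟨⟨0, hN0⟩⟩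
  have hm : Measurable (fun x : Space N => (min (‖x‖ ^ 2) 1)⁻¹) := by fun_prop
  refine (hK.integrable.1.mul hm.aestronglyMeasurable).congr ?_
  filter_upwards [compl_mem_ae_iff.2 (measure_singleton (0 : Space N))] with x hx
  have hx0 : x ≠ 0 := hx
  have : min (‖x‖ ^ 2) 1 ≠ 0 := (lt_min (by positivity) one_pos).ne'
  simp only [Pi.mul_apply]
  field_simp

theorem energyDensity_aestronglyMeasurable {N : ℕ} {K : Space N → ℝ} (hK : IsKernel K)
    {u v : Space N → ℝ} (hu : AEStronglyMeasurable u volume)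
    (hv : AEStronglyMeasurable v volume) :
    AEStronglyMeasurable (energyDensity K u v) (volume : Measure (Space N × Space N)) := by
  have hk : AEStronglyMeasurable (fun p : Space N × Space N => K (p.1 - p.2)) volume :=
    (kernel_aestronglyMeasurable hK).comp_quasiMeasurePreserving
      (quasiMeasurePreserving_sub_of_right_invariant volume volume)
  exact ((hu.comp_fst.sub hu.comp_snd).mul (hv.comp_fst.sub hv.comp_snd)).mul hk

theorem FiniteEnergy.add {N : ℕ} {K : Space N → ℝ} (hK : IsKernel K) {u v : Space N → ℝ}
    (hum : AEStronglyMeasurable u volume) (hvm : AEStronglyMeasurable v volume)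
    (hu : FiniteEnergy K u) (hv : FiniteEnergy K v) : FiniteEnergy K (u + v) := by
  refine Integrable.mono' ((Integrable.add hu hv).const_mul 2)
    (energyDensity_aestronglyMeasurable hK (hum.add hvm) (hum.add hvm)) (ae_of_all _ ?_)
  rintro ⟨x, y⟩
  by_cases h : x - y = 0
  · have : x = y := sub_eq_zero.1 h
    simp [energyDensity, this]
  · have hk := hK.pos _ h
    simp only [energyDensity, Pi.add_apply, Real.norm_eq_abs]
    rw [abs_of_nonneg (mul_nonneg (mul_self_nonneg _) hk.le)]
    nlinarith [mul_nonneg hk.le (mul_self_nonneg ((u x - u y) - (v x - v y)))]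

theorem FiniteEnergy.smul {N : ℕ} {K : Space N → ℝ} (c : ℝ) {u : Space N → ℝ}
    (hu : FiniteEnergy K u) : FiniteEnergy K (c • u) := by
  refine (Integrable.const_mul hu (c ^ 2)).congr (ae_of_all _ fun p => ?_)
  simp only [energyDensity, Pi.smul_apply, smul_eq_mul]
  ring

/-- The space `X_K(Ω)` of the (classes of) functions `u ∈ L²(ℝ^N)` with `[u]_K < ∞` and `u = 0`
a.e. in `ℝ^N ∖ Ω`. Its norm is `normK` below, not the norm inherited from `L²`. -/
def XK {N : ℕ} (Ω : Set (Space N)) {K : Space N → ℝ} (hK : IsKernel K) :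
    Submodule ℝ (Lp ℝ 2 (volume : Measure (Space N))) where
  carrier := {u | FiniteEnergy K u ∧ u =ᵐ[volume.restrict Ωᶜ] (0 : Space N → ℝ)}
  zero_mem' := by
    have h := Lp.coeFn_zero ℝ 2 (volume : Measure (Space N))
    refine ⟨FiniteEnergy.congr ?_ h.symm, ae_restrict_of_ae h⟩
    refine (integrable_zero _ _ _).congr (ae_of_all _ fun p => ?_)
    simp [energyDensity]
  add_mem' := by
    rintro u v ⟨hu, hu0⟩ ⟨hv, hv0⟩
    have h := Lp.coeFn_add u v
    refine ⟨(FiniteEnergy.add hK (Lp.aestronglyMeasurable u) (Lp.aestronglyMeasurable v)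
      hu hv).congr h.symm, ?_⟩
    filter_upwards [ae_restrict_of_ae h, hu0, hv0] with x h1 h2 h3
    exact h1.trans (by simp [h2, h3])
  smul_mem' := by
    rintro c u ⟨hu, hu0⟩
    have h := Lp.coeFn_smul c u
    refine ⟨(FiniteEnergy.smul c hu).congr h.symm, ?_⟩
    filter_upwards [ae_restrict_of_ae h, hu0] with x h1 h2
    exact h1.trans (by simp [h2])

variable {N : ℕ} {Ω : Set (Space N)} {K : Space N → ℝ} {hK : IsKernel K}

/-- The scalar product of `X_K(Ω)`. -/
def innerK (u v : XK Ω hK) : ℝ :=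
  ∫ p : Space N × Space N, energyDensity K (u : Lp ℝ 2 volume) (v : Lp ℝ 2 volume) p

/-- The norm `[u]_K` of `X_K(Ω)`. -/
def normK (u : XK Ω hK) : ℝ := √(innerK u u)

/-- The weights: `L^∞(Ω)`, with its a.e. equality and its a.e. order. -/
abbrev Weight (Ω : Set (Space N)) : Type := Lp ℝ ∞ (volume.restrict Ω)

/-- `∫_Ω ρ u v dx`. -/
def weightForm (ρ : Weight Ω) (u v : XK Ω hK) : ℝ :=
  ∫ x in Ω, ρ x * (u : Lp ℝ 2 volume) x * (v : Lp ℝ 2 volume) x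

/-- `u` is an eigenfunction with eigenvalue `l` of the problem `L_K u = l ρ u` in `Ω`, `u = 0`
outside `Ω`: a nontrivial weak solution. -/
def IsEigenfunction (ρ : Weight Ω) (l : ℝ) (u : XK Ω hK) : Prop :=
  u ≠ 0 ∧ ∀ v : XK Ω hK, innerK u v = l * weightForm ρ u v

variable (hK) in
/-- Unique continuation property: every eigenfunction (for every eigenvalue) vanishes in `Ω` at
most on a null set. -/
def HasUCP (ρ : Weight Ω) : Prop :=
  ∀ (l : ℝ) (u : XK Ω hK), IsEigenfunction ρ l u →
    volume {x ∈ Ω | (u : Lp ℝ 2 volume) x = 0} = 0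

/-- The values `∫_Ω ρ u² dx` for `u ∈ F`, `‖u‖ = 1`. -/
def rayleighValues (ρ : Weight Ω) (F : Submodule ℝ (XK Ω hK)) : Set ℝ :=
  (fun u => weightForm ρ u u) '' {u | u ∈ F ∧ normK u = 1}

variable (hK) in
/-- For `k > 0`: `sup` over the `k`-dimensional subspaces `F` of `X_K(Ω)` of the `inf` of
`∫_Ω ρ u² dx` over `u ∈ F`, `‖u‖ = 1`. -/
def supInf (ρ : Weight Ω) (k : ℕ) : ℝ :=
  sSup {t | ∃ F : Submodule ℝ (XK Ω hK), Module.finrank ℝ F = k ∧ t = sInf (rayleighValues ρ F)}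

variable (hK) in
/-- For `k > 0`: `inf` over the `k`-dimensional subspaces `F` of `X_K(Ω)` of the `sup` of
`∫_Ω ρ u² dx` over `u ∈ F`, `‖u‖ = 1`. -/
def infSup (ρ : Weight Ω) (k : ℕ) : ℝ :=
  sInf {t | ∃ F : Submodule ℝ (XK Ω hK), Module.finrank ℝ F = k ∧ t = sSup (rayleighValues ρ F)}

variable (hK) in
/-- The variational eigenvalue `λ_k(ρ)`, `k ∈ ℤ ∖ {0}`; meaningful for admissible `k`. -/
def eigenvalue (ρ : Weight Ω) (k : ℤ) : ℝ :=
  if 0 < k then (supInf hK ρ k.natAbs)⁻¹ else (infSup hK ρ k.natAbs)⁻¹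

/-- `k ∈ ℤ ∖ {0}` is admissible for `ρ`: positive `k` if `ρ⁺ ≢ 0`, negative `k` if `ρ⁻ ≢ 0`. -/
def Admissible (ρ : Weight Ω) (k : ℤ) : Prop :=
  (0 < k ∧ ρ⁺ ≠ 0) ∨ (k < 0 ∧ ρ⁻ ≠ 0)

end NonlocalEig

end

/-! Let `u` be an eigenfunction with eigenvalue `l > 0` that vanishes on a set `A ⊆ Ω` of positive
measure, and let `χ` be the indicator of `A`. Since `χ u = 0`, `u` solves the same equation for
every weight `ρ + t χ`, so `c = l⁻¹` remains a critical value for all `t`. What has to be found is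
one index `k` giving this value at both `t = 0` and some `t > 0`.

Consider the dimensions on which `∫ ρ v² ≥ c ‖v‖²` (`DominatesOnDim`). Compactness of the embedding
in `L²` bounds them (`DominatesOnDim.exists_bound`), so there is a `k` that is reached for every `t
> 0` while `k + 1` fails for some `t > 0`. At that `t` the `k`-th value is exactly `c`: if it were
larger, adjoining `u` to a good subspace would reach dimension `k + 1`
(`DominatesOnDim.succ_of_lt`). For `ρ` itself, monotonicity in the weight gives `≤ c`, and the bound
for `ρ + τ χ` with `τ → 0⁺` gives `≥ c`. No maximizing subspace or spectral decomposition is needed.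

The case `l < 0` follows by changing the sign of the weight, and `l = 0` is excluded because the
energy is definite. -/

noncomputable section

namespace NonlocalEig

/-! ### Bilinearity and integrability of the two forms -/

section Forms

variable {N : ℕ} {Ω : Set (Space N)} {K : Space N → ℝ} {hK : IsKernel K}

theorem energyDensity_self_nonneg (hK : IsKernel K) (u : Space N → ℝ) (p : Space N × Space N) :
    0 ≤ energyDensity K u u p := by
  by_cases h : p.1 - p.2 = 0
  · simp [energyDensity, sub_eq_zero.1 h]
  · exact mul_nonneg (mul_self_nonneg _) (hK.pos _ h).le

theorem integrable_energyDensity (u v : XK Ω hK) :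
    Integrable (energyDensity K (u : Lp ℝ 2 volume) (v : Lp ℝ 2 volume))
      (volume : Measure (Space N × Space N)) := by
  refine Integrable.mono' (Integrable.add u.2.1 v.2.1)
    (energyDensity_aestronglyMeasurable hK (Lp.aestronglyMeasurable _)
      (Lp.aestronglyMeasurable _)) (ae_of_all _ ?_)
  rintro ⟨x, y⟩
  by_cases h : x - y = 0
  · simp [energyDensity, sub_eq_zero.1 h]
  · have hk := hK.pos _ h
    simp only [energyDensity, Pi.add_apply, Real.norm_eq_abs]
    rw [abs_mul, abs_of_pos hk, ← add_mul]
    refine mul_le_mul_of_nonneg_right ?_ hk.le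
    set a := (u : Lp ℝ 2 volume) x - (u : Lp ℝ 2 volume) y
    set b := (v : Lp ℝ 2 volume) x - (v : Lp ℝ 2 volume) y
    rw [abs_le]
    -- `|a b| ≤ a² + b²`, so the two energies dominate the mixed density.
    constructor <;> nlinarith [sq_nonneg (a + b), sq_nonneg (a - b), sq_nonneg a, sq_nonneg b]

theorem innerK_comm (u v : XK Ω hK) : innerK u v = innerK v u := by
  refine integral_congr_ae (ae_of_all _ fun p => ?_)
  simp only [energyDensity]
  ring

theorem innerK_add_left (u v w : XK Ω hK) : innerK (u + v) w = innerK u w + innerK v w := by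
  rw [innerK, innerK, innerK,
    ← integral_add (integrable_energyDensity u w) (integrable_energyDensity v w)]
  refine integral_congr_ae ?_
  filter_upwards [energyDensity_congr K
    (Lp.coeFn_add (u : Lp ℝ 2 (volume : Measure (Space N))) v) (ae_eq_refl _)] with p hp
  refine Eq.trans hp ?_
  simp only [energyDensity, Pi.add_apply]
  ring

theorem innerK_smul_left (c : ℝ) (u w : XK Ω hK) : innerK (c • u) w = c * innerK u w := by
  rw [innerK, innerK, ← integral_const_mul]
  refine integral_congr_ae ?_
  filter_upwards [energyDensity_congr K
    (Lp.coeFn_smul c (u : Lp ℝ 2 (volume : Measure (Space N)))) (ae_eq_refl _)] with p hp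
  refine Eq.trans hp ?_
  simp only [energyDensity, Pi.smul_apply, smul_eq_mul]
  ring

theorem innerK_self_nonneg (u : XK Ω hK) : 0 ≤ innerK u u :=
  integral_nonneg fun p => energyDensity_self_nonneg hK _ p

theorem normK_eq_one_iff (u : XK Ω hK) : normK u = 1 ↔ innerK u u = 1 := by
  rw [normK, Real.sqrt_eq_one]

theorem Weight.ae_abs_le_norm (ρ : Weight Ω) : ∀ᵐ x ∂volume.restrict Ω, |ρ x| ≤ ‖ρ‖ := by
  filter_upwards [ae_le_eLpNormEssSup (f := ρ) (μ := volume.restrict Ω)] with x hx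
  have hfin : eLpNormEssSup ρ (volume.restrict Ω) ≠ ∞ := by
    simpa using (Lp.memLp ρ).eLpNorm_ne_top
  rw [Lp.norm_def, eLpNorm_exponent_top]
  simpa using ENNReal.toReal_mono hfin hx

theorem integrable_mul_coe (u v : XK Ω hK) :
    Integrable (fun x : Space N => (u : Lp ℝ 2 volume) x * (v : Lp ℝ 2 volume) x) volume :=
  (Lp.memLp (u : Lp ℝ 2 (volume : Measure (Space N)))).integrable_mul
    (Lp.memLp (v : Lp ℝ 2 (volume : Measure (Space N))))

theorem integrable_weight_mul (ρ : Weight Ω) (u v : XK Ω hK) :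
    Integrable (fun x => ρ x * (u : Lp ℝ 2 volume) x * (v : Lp ℝ 2 volume) x)
      (volume.restrict Ω) := by
  simp only [mul_assoc]
  exact (integrable_mul_coe u v).restrict.bdd_mul (Lp.aestronglyMeasurable ρ)
    ρ.ae_abs_le_norm

theorem weightForm_comm (ρ : Weight Ω) (u v : XK Ω hK) :
    weightForm ρ u v = weightForm ρ v u := by
  refine integral_congr_ae (ae_of_all _ fun p => ?_)
  ring

theorem weightForm_add_left (ρ : Weight Ω) (u v w : XK Ω hK) :
    weightForm ρ (u + v) w = weightForm ρ u w + weightForm ρ v w := by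
  rw [weightForm, weightForm, weightForm,
    ← integral_add (integrable_weight_mul ρ u w) (integrable_weight_mul ρ v w)]
  refine integral_congr_ae ?_
  filter_upwards [ae_restrict_of_ae (Lp.coeFn_add (u : Lp ℝ 2 (volume : Measure (Space N))) v)]
    with x hx
  have hx' : ((u + v : XK Ω hK) : Lp ℝ 2 volume) x =
    (u : Lp ℝ 2 volume) x + (v : Lp ℝ 2 volume) x := hx
  rw [hx']
  ring

theorem weightForm_smul_left (ρ : Weight Ω) (c : ℝ) (u w : XK Ω hK) :
    weightForm ρ (c • u) w = c * weightForm ρ u w := by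
  rw [weightForm, weightForm, ← integral_const_mul]
  refine integral_congr_ae ?_
  filter_upwards [ae_restrict_of_ae (Lp.coeFn_smul c (u : Lp ℝ 2 (volume : Measure (Space N))))]
    with x hx
  have hx' : ((c • u : XK Ω hK) : Lp ℝ 2 volume) x = c * (u : Lp ℝ 2 volume) x := hx
  rw [hx']
  ring

theorem weightForm_add_weight (ρ σ : Weight Ω) (u v : XK Ω hK) :
    weightForm (ρ + σ) u v = weightForm ρ u v + weightForm σ u v := by
  rw [weightForm, weightForm, weightForm,
    ← integral_add (integrable_weight_mul ρ u v) (integrable_weight_mul σ u v)]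
  refine integral_congr_ae ?_
  filter_upwards [Lp.coeFn_add ρ σ] with x hx
  rw [hx, Pi.add_apply]
  ring

theorem weightForm_smul_weight (c : ℝ) (ρ : Weight Ω) (u v : XK Ω hK) :
    weightForm (c • ρ) u v = c * weightForm ρ u v := by
  rw [weightForm, weightForm, ← integral_const_mul]
  refine integral_congr_ae ?_
  filter_upwards [Lp.coeFn_smul c ρ] with x hx
  rw [hx, Pi.smul_apply, smul_eq_mul]
  ring

theorem weightForm_neg_weight (ρ : Weight Ω) (u v : XK Ω hK) :
    weightForm (-ρ) u v = -weightForm ρ u v := by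
  have := weightForm_smul_weight (-1) ρ u v
  rwa [neg_one_smul, neg_one_mul] at this

theorem weightForm_self_nonneg {ρ : Weight Ω} (hρ : 0 ≤ ρ) (u : XK Ω hK) :
    0 ≤ weightForm ρ u u := by
  refine integral_nonneg_of_ae ?_
  filter_upwards [(Lp.coeFn_nonneg ρ).2 hρ] with x hx
  rw [mul_assoc]
  exact mul_nonneg hx (mul_self_nonneg _)

theorem weightForm_self_le (ρ : Weight Ω) (u : XK Ω hK) :
    weightForm ρ u u ≤ ‖ρ‖ * ∫ x in Ω, (u : Lp ℝ 2 volume) x * (u : Lp ℝ 2 volume) x := by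
  rw [weightForm, ← integral_const_mul]
  refine integral_mono_ae (integrable_weight_mul ρ u u)
    ((integrable_mul_coe u u).restrict.const_mul _) ?_
  filter_upwards [ρ.ae_abs_le_norm] with x hx
  rw [mul_assoc]
  exact mul_le_mul_of_nonneg_right ((le_abs_self _).trans hx) (mul_self_nonneg _)

/-- `∫_Q u = 0` controls `∫_Q u²` by the double integral of `(u(x) - u(y))²`. -/
theorem two_mul_measureReal_mul_setIntegral (u : XK Ω hK) {Q : Set (Space N)}
    (hQ : volume Q ≠ ∞) (hu : ∫ x in Q, (u : Lp ℝ 2 volume) x = 0) :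
    2 * volume.real Q * ∫ x in Q, (u : Lp ℝ 2 volume) x * (u : Lp ℝ 2 volume) x =
      ∫ p : Space N × Space N in Q ×ˢ Q, ((u : Lp ℝ 2 volume) p.1 - (u : Lp ℝ 2 volume) p.2) ^ 2 := by
  have : IsFiniteMeasure (volume.restrict Q) := ⟨by simpa using hQ.lt_top⟩
  set f : Space N → ℝ := ⇑(u : Lp ℝ 2 (volume : Measure (Space N)))
  have hf2 : Integrable (fun x => f x * f x) (volume.restrict Q) :=
    (integrable_mul_coe u u).restrict
  have hf : Integrable f (volume.restrict Q) :=
    ((Lp.memLp (u : Lp ℝ 2 (volume : Measure (Space N)))).restrict Q).integrable one_le_two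
  have h1 := hf2.mul_prod (integrable_const (μ := volume.restrict Q) (1 : ℝ))
  have h2 := hf.mul_prod hf
  have h3 := (integrable_const (μ := volume.restrict Q) (1 : ℝ)).mul_prod hf2
  have h12 : Integrable (fun p : Space N × Space N =>
      (f p.1 * f p.1) * 1 - 2 * (f p.1 * f p.2))
      ((volume.restrict Q).prod (volume.restrict Q)) := h1.sub (h2.const_mul 2)
  have e : ∀ p : Space N × Space N, (f p.1 - f p.2) ^ 2 =
      (f p.1 * f p.1) * 1 - 2 * (f p.1 * f p.2) + 1 * (f p.2 * f p.2) := fun p => by ring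
  -- After expanding the square, the cross term integrates to `(∫_Q u)² = 0`, and each of the two
  -- remaining terms gives `|Q| ∫_Q u²`.
  simp only [e]
  rw [Measure.volume_eq_prod, ← Measure.prod_restrict, integral_add h12 h3,
    integral_sub h1 (h2.const_mul 2), integral_const_mul,
    integral_prod_mul (fun x => f x * f x) (fun _ => (1 : ℝ)), integral_prod_mul f f,
    integral_prod_mul (fun _ => (1 : ℝ)) (fun x => f x * f x), hu]
  simp
  ring

/-- The lower bound on the kernel, for a pair of points at distance at most `d`. -/
theorem sq_sub_le_energyDensity {α s : ℝ} (hα : 0 < α) (hs : 0 < s)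
    (hlow : ∀ x, x ≠ 0 → α * ‖x‖ ^ (-((N : ℝ) + 2 * s)) ≤ K x) {d : ℝ}
    (u : Space N → ℝ) {p : Space N × Space N} (hp : ‖p.1 - p.2‖ ≤ d) :
    (u p.1 - u p.2) ^ 2 ≤ d ^ ((N : ℝ) + 2 * s) / α * energyDensity K u u p := by
  by_cases h : p.1 - p.2 = 0
  · simp [energyDensity, sub_eq_zero.1 h]
  have hn : 0 < ‖p.1 - p.2‖ := norm_pos_iff.2 h
  have hd : 0 < d := hn.trans_le hp
  have key : 1 ≤ d ^ ((N : ℝ) + 2 * s) / α * K (p.1 - p.2) := by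
    have h1 : d ^ (-((N : ℝ) + 2 * s)) ≤ ‖p.1 - p.2‖ ^ (-((N : ℝ) + 2 * s)) :=
      Real.rpow_le_rpow_of_nonpos hn hp (by have : (0 : ℝ) ≤ N := Nat.cast_nonneg N; linarith)
    have hd' : 0 < d ^ ((N : ℝ) + 2 * s) := Real.rpow_pos_of_pos hd _
    calc (1 : ℝ) = d ^ ((N : ℝ) + 2 * s) / α * (α * d ^ (-((N : ℝ) + 2 * s))) := by
          rw [Real.rpow_neg hd.le]; field_simp
      _ ≤ _ := by
          refine mul_le_mul_of_nonneg_left ?_ (by positivity)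
          exact (mul_le_mul_of_nonneg_left h1 hα.le).trans (hlow _ h)
  have := mul_le_mul_of_nonneg_left key (sq_nonneg (u p.1 - u p.2))
  simp only [energyDensity]
  linarith

end Forms

/-! ### Poincaré inequality and definiteness of the energy -/

section Inequalities

variable {N : ℕ} {Ω : Set (Space N)} {K : Space N → ℝ} {hK : IsKernel K}

theorem setIntegral_sq_sub_le {α s : ℝ} (hα : 0 < α) (hs : 0 < s)
    (hlow : ∀ x, x ≠ 0 → α * ‖x‖ ^ (-((N : ℝ) + 2 * s)) ≤ K x) {d : ℝ} (u : XK Ω hK)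
    {S : Set (Space N × Space N)} (hS : MeasurableSet S) (hd : ∀ p ∈ S, ‖p.1 - p.2‖ ≤ d) :
    ∫ p : Space N × Space N in S, ((u : Lp ℝ 2 volume) p.1 - (u : Lp ℝ 2 volume) p.2) ^ 2 ≤
      d ^ ((N : ℝ) + 2 * s) / α *
        ∫ p : Space N × Space N in S, energyDensity K (u : Lp ℝ 2 volume) (u : Lp ℝ 2 volume) p := by
  rw [← integral_const_mul]
  refine integral_mono_of_nonneg (ae_of_all _ fun p => sq_nonneg _)
    ((integrable_energyDensity u u).restrict.const_mul _) ?_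
  filter_upwards [ae_restrict_mem hS] with p hp
  exact sq_sub_le_energyDensity hα hs hlow _ (hd p hp)

theorem IsKernel.dim_pos (hK : IsKernel K) : 0 < N := by
  obtain ⟨_, s, _, hs, _, hN, _⟩ := hK.lower_bound
  have : (0 : ℝ) < N := by linarith
  exact_mod_cast this

/-- Poincaré inequality. -/
theorem exists_poincare_const (hΩm : MeasurableSet Ω) (hΩ : Bornology.IsBounded Ω) :
    ∃ C : ℝ, 0 < C ∧ ∀ u : XK Ω hK,
      ∫ x in Ω, (u : Lp ℝ 2 volume) x * (u : Lp ℝ 2 volume) x ≤ C * innerK u u := by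
  obtain ⟨α, s, hα, hs, -, -, hlow⟩ := hK.lower_bound
  have : Nonempty (Fin N) := ⟨⟨0, hK.dim_pos⟩⟩
  obtain ⟨R, hR, hΩR⟩ := hΩ.subset_ball_lt 0 (0 : Space N)
  -- With `Ω` inside the ball of radius `R` about `0`, the ball of radius `R` about a point of norm
  -- `3R` misses `Ω`, so `u = 0` on it. Points of the two sets are at distance at most `5R`, where
  -- the kernel is bounded below.
  obtain ⟨e, he⟩ := exists_norm_eq (Space N) (show 0 ≤ 3 * R by positivity)
  set B := Metric.ball e R
  have hBΩ : B ⊆ Ωᶜ := fun y hy hyΩ => by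
    have h1 : ‖y‖ < R := by simpa using hΩR hyΩ
    have h2 : ‖y - e‖ < R := by simpa [dist_eq_norm, B] using hy
    have h3 : ‖e‖ ≤ ‖y‖ + ‖y - e‖ := by
      simpa using norm_sub_le y (y - e)
    linarith
  have hBpos : 0 < volume.real B :=
    ENNReal.toReal_pos (Metric.measure_ball_pos volume e hR).ne' measure_ball_lt_top.ne
  have hd : ∀ p ∈ Ω ×ˢ B, ‖p.1 - p.2‖ ≤ 5 * R := by
    rintro ⟨x, y⟩ ⟨hx, hy⟩
    have h1 : ‖x‖ < R := by simpa using hΩR hx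
    have h2 : ‖y - e‖ < R := by simpa [dist_eq_norm, B] using hy
    have h3 : ‖x - y‖ ≤ ‖x‖ + ‖y‖ := norm_sub_le x y
    have h4 : ‖y‖ ≤ ‖y - e‖ + ‖e‖ := by simpa using norm_add_le (y - e) e
    simp only
    linarith
  refine ⟨(5 * R) ^ ((N : ℝ) + 2 * s) / α / volume.real B, by positivity, fun u => ?_⟩
  have hzero : ∀ᵐ p ∂(volume.restrict Ω).prod (volume.restrict B),
      (u : Lp ℝ 2 volume) p.2 = 0 := by
    have h : (u : Lp ℝ 2 volume) =ᵐ[volume.restrict B] (0 : Space N → ℝ) :=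
      ae_mono (Measure.restrict_mono_set volume hBΩ) u.2.2
    exact Measure.quasiMeasurePreserving_snd.ae h
  have key : volume.real B * ∫ x in Ω, (u : Lp ℝ 2 volume) x * (u : Lp ℝ 2 volume) x =
      ∫ p : Space N × Space N in Ω ×ˢ B, ((u : Lp ℝ 2 volume) p.1 - (u : Lp ℝ 2 volume) p.2) ^ 2 := by
    rw [Measure.volume_eq_prod, ← Measure.prod_restrict]
    have : ∫ p : Space N × Space N, ((u : Lp ℝ 2 volume) p.1 - (u : Lp ℝ 2 volume) p.2) ^ 2
          ∂(volume.restrict Ω).prod (volume.restrict B) =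
        ∫ p : Space N × Space N, ((u : Lp ℝ 2 volume) p.1 * (u : Lp ℝ 2 volume) p.1) * 1
          ∂(volume.restrict Ω).prod (volume.restrict B) := by
      refine integral_congr_ae ?_
      filter_upwards [hzero] with p hp
      rw [hp]
      ring
    rw [this, integral_prod_mul
      (fun x : Space N => (u : Lp ℝ 2 volume) x * (u : Lp ℝ 2 volume) x) (fun _ => (1 : ℝ))]
    simp [mul_comm]
  have h1 := setIntegral_sq_sub_le hα hs hlow u (hΩm.prod measurableSet_ball) hd
  have h2 : ∫ p : Space N × Space N in Ω ×ˢ B, energyDensity K (u : Lp ℝ 2 volume) (u : Lp ℝ 2 volume) p ≤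
      innerK u u :=
    setIntegral_le_integral (integrable_energyDensity u u)
      (ae_of_all _ fun p => energyDensity_self_nonneg hK _ p)
  have h3 := mul_le_mul_of_nonneg_left h2
    (show 0 ≤ (5 * R) ^ ((N : ℝ) + 2 * s) / α by positivity)
  rw [div_mul_eq_mul_div, le_div_iff₀ hBpos]
  linarith

/-- Zero energy forces `u = 0` a.e. in `Ω` by Poincaré; outside `Ω` this is part of membership in
`XK`. -/
theorem innerK_self_pos (hΩm : MeasurableSet Ω) (hΩ : Bornology.IsBounded Ω) {u : XK Ω hK}
    (hu : u ≠ 0) : 0 < innerK u u := by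
  obtain ⟨C, hC, h⟩ := exists_poincare_const (hK := hK) hΩm hΩ
  refine (innerK_self_nonneg u).lt_of_ne' fun h0 => hu ?_
  have hle := h u
  rw [h0, mul_zero] at hle
  have heq : ∫ x in Ω, (u : Lp ℝ 2 volume) x * (u : Lp ℝ 2 volume) x = 0 :=
    hle.antisymm (integral_nonneg fun x => mul_self_nonneg _)
  rw [integral_eq_zero_iff_of_nonneg (fun x => mul_self_nonneg _)
    (integrable_mul_coe u u).restrict] at heq
  refine Subtype.ext (Lp.ext ?_)
  refine Filter.EventuallyEq.trans ?_ (Lp.coeFn_zero ℝ 2 (volume : Measure (Space N))).symm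
  refine ae_of_ae_restrict_of_ae_restrict_compl Ω ?_ u.2.2
  filter_upwards [heq] with x hx
  exact mul_self_eq_zero.1 hx

/-! ### Compactness of the embedding, by a decomposition into cubes -/

/-- The half-open cubes of side `δ` of the lattice `δ ℤ^N`. -/
def cube (N : ℕ) (δ : ℝ) (k : Fin N → ℤ) : Set (Space N) := {x | ∀ i, ⌊x i / δ⌋ = k i}

theorem cube_eq_preimage {δ : ℝ} (hδ : 0 < δ) (k : Fin N → ℤ) :
    cube N δ k = WithLp.ofLp ⁻¹' (univ.pi fun i => Ico (k i * δ) ((k i + 1) * δ)) := by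
  ext x
  simp only [cube, mem_ofPred_eq, mem_preimage, mem_pi, mem_univ, true_imp_iff, mem_Ico]
  refine forall_congr' fun i => ?_
  rw [Int.floor_eq_iff, le_div_iff₀ hδ, div_lt_iff₀ hδ]

theorem measurableSet_cube {δ : ℝ} (hδ : 0 < δ) (k : Fin N → ℤ) :
    MeasurableSet (cube N δ k) := by
  rw [cube_eq_preimage hδ]
  exact (PiLp.volume_preserving_ofLp (Fin N)).measurable
    (MeasurableSet.univ_pi fun i => measurableSet_Ico)

theorem volume_cube {δ : ℝ} (hδ : 0 < δ) (k : Fin N → ℤ) :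
    volume (cube N δ k) = ENNReal.ofReal (δ ^ N) := by
  rw [cube_eq_preimage hδ, (PiLp.volume_preserving_ofLp (Fin N)).measure_preimage
    (MeasurableSet.univ_pi fun i => measurableSet_Ico).nullMeasurableSet, Real.volume_pi_Ico]
  have : ∀ i, ((k i : ℝ) + 1) * δ - k i * δ = δ := fun i => by ring
  simp [this, ENNReal.ofReal_pow hδ.le]

theorem disjoint_cube (δ : ℝ) {k l : Fin N → ℤ} (h : k ≠ l) :
    Disjoint (cube N δ k) (cube N δ l) :=
  Set.disjoint_left.2 fun _ hx hy => h (funext fun i => (hx i).symm.trans (hy i))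

theorem norm_sub_le_of_mem_cube {δ : ℝ} (hδ : 0 < δ) {k : Fin N → ℤ} {x y : Space N}
    (hx : x ∈ cube N δ k) (hy : y ∈ cube N δ k) : ‖x - y‖ ≤ √N * δ := by
  rw [cube_eq_preimage hδ] at hx hy
  simp only [mem_preimage, mem_pi, mem_univ, true_imp_iff, mem_Ico] at hx hy
  rw [EuclideanSpace.norm_eq, Real.sqrt_le_left (by positivity), mul_pow,
    Real.sq_sqrt (Nat.cast_nonneg N)]
  calc ∑ i, ‖(x - y) i‖ ^ 2 ≤ ∑ _i : Fin N, δ ^ 2 := by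
        refine Finset.sum_le_sum fun i _ => ?_
        rw [Real.norm_eq_abs, sq_abs]
        refine sq_le_sq' ?_ ?_ <;> simp only [PiLp.sub_apply] <;>
          linarith [(hx i).1, (hx i).2, (hy i).1, (hy i).2]
    _ = _ := by simp

theorem exists_finset_subset_iUnion_cube {δ : ℝ} (hδ : 0 < δ) (hΩ : Bornology.IsBounded Ω) :
    ∃ S : Finset (Fin N → ℤ), Ω ⊆ ⋃ k ∈ S, cube N δ k := by
  obtain ⟨R, hR, hΩR⟩ := hΩ.subset_ball_lt 0 (0 : Space N)
  refine ⟨Fintype.piFinset fun _ => Finset.Icc ⌊-R / δ⌋ ⌊R / δ⌋, fun x hx => ?_⟩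
  have hxR : ‖x‖ < R := by simpa using hΩR hx
  simp only [mem_iUnion, Fintype.mem_piFinset, Finset.mem_Icc]
  refine ⟨fun i => ⌊x i / δ⌋, fun i => ?_, fun i => rfl⟩
  have hi := abs_le.1 ((PiLp.norm_apply_le x i).trans hxR.le)
  exact ⟨Int.floor_le_floor (div_le_div_of_nonneg_right hi.1 hδ.le),
    Int.floor_le_floor (div_le_div_of_nonneg_right hi.2 hδ.le)⟩

/-- On a cube of side `δ` the variance identity gives `2 δ^N ∫ u² ≤ (√N δ)^(N + 2s) / α` times the
energy on the cube squared; dividing by `δ^N` leaves the small factor `δ^(2s)`. -/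
theorem setIntegral_mul_self_le_of_cube_mean_eq_zero {α s : ℝ} (hα : 0 < α) (hs : 0 < s)
    (hlow : ∀ x, x ≠ 0 → α * ‖x‖ ^ (-((N : ℝ) + 2 * s)) ≤ K x) {δ : ℝ} (hδ : 0 < δ)
    {S : Finset (Fin N → ℤ)} (hS : Ω ⊆ ⋃ k ∈ S, cube N δ k) (u : XK Ω hK)
    (hu : ∀ k ∈ S, ∫ x in cube N δ k, (u : Lp ℝ 2 volume) x = 0) :
    ∫ x in Ω, (u : Lp ℝ 2 volume) x * (u : Lp ℝ 2 volume) x ≤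
      √N ^ ((N : ℝ) + 2 * s) / (2 * α) * δ ^ (2 * s) * innerK u u := by
  have hcube : ∀ k ∈ S, ∫ x in cube N δ k, (u : Lp ℝ 2 volume) x * (u : Lp ℝ 2 volume) x ≤
      √N ^ ((N : ℝ) + 2 * s) / (2 * α) * δ ^ (2 * s) *
        ∫ p : Space N × Space N in cube N δ k ×ˢ cube N δ k,
          energyDensity K (u : Lp ℝ 2 volume) (u : Lp ℝ 2 volume) p := by
    intro k hk
    have h1 := two_mul_measureReal_mul_setIntegral u
      (by rw [volume_cube hδ]; exact ENNReal.ofReal_ne_top) (hu k hk)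
    have h2 := setIntegral_sq_sub_le hα hs hlow u (d := √N * δ)
      ((measurableSet_cube hδ k).prod (measurableSet_cube hδ k))
      (fun p hp => norm_sub_le_of_mem_cube hδ hp.1 hp.2)
    rw [← h1, measureReal_def, volume_cube hδ, ENNReal.toReal_ofReal (by positivity),
      Real.mul_rpow (by positivity) hδ.le, Real.rpow_add hδ, Real.rpow_natCast] at h2
    have hδN : 0 < δ ^ N := by positivity
    refine le_of_mul_le_mul_left (h2.trans_eq ?_) (show 0 < 2 * δ ^ N by positivity)
    field_simp
  have hmeas := fun k (_ : k ∈ S) => measurableSet_cube (N := N) hδ k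
  calc ∫ x in Ω, (u : Lp ℝ 2 volume) x * (u : Lp ℝ 2 volume) x
      ≤ ∫ x in ⋃ k ∈ S, cube N δ k, (u : Lp ℝ 2 volume) x * (u : Lp ℝ 2 volume) x :=
        setIntegral_mono_set (integrable_mul_coe u u).integrableOn
          (ae_of_all _ fun x => mul_self_nonneg _) hS.eventuallyLE
    _ = ∑ k ∈ S, ∫ x in cube N δ k, (u : Lp ℝ 2 volume) x * (u : Lp ℝ 2 volume) x :=
        integral_biUnion_finset S hmeas (fun k _ l _ h => disjoint_cube δ h)
          fun k _ => (integrable_mul_coe u u).integrableOn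
    _ ≤ _ := Finset.sum_le_sum hcube
    _ = √N ^ ((N : ℝ) + 2 * s) / (2 * α) * δ ^ (2 * s) *
        ∫ p : Space N × Space N in ⋃ k ∈ S, cube N δ k ×ˢ cube N δ k,
          energyDensity K (u : Lp ℝ 2 volume) (u : Lp ℝ 2 volume) p := by
        rw [← Finset.mul_sum, integral_biUnion_finset S
          (fun k hk => (hmeas k hk).prod (hmeas k hk))
          (fun k _ l _ h => Set.disjoint_prod.2 (Or.inl (disjoint_cube δ h)))
          fun k _ => (integrable_energyDensity u u).integrableOn]
    -- The products `Q ×ˢ Q` are disjoint, so their energies add up to at most the whole energy.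
    _ ≤ _ := by
        refine mul_le_mul_of_nonneg_left ?_ (by positivity)
        exact setIntegral_le_integral (integrable_energyDensity u u)
          (ae_of_all _ fun p => energyDensity_self_nonneg hK _ p)

/-- Integration over a set of finite measure. -/
def setIntegralLinear (hK : IsKernel K) {Q : Set (Space N)} (hQ : volume Q ≠ ∞) :
    XK Ω hK →ₗ[ℝ] ℝ where
  toFun u := ∫ x in Q, (u : Lp ℝ 2 volume) x
  map_add' u v := by
    have : IsFiniteMeasure (volume.restrict Q) := ⟨by simpa using hQ.lt_top⟩
    have hint : ∀ w : Lp ℝ 2 (volume : Measure (Space N)), Integrable w (volume.restrict Q) :=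
      fun w => ((Lp.memLp w).restrict Q).integrable one_le_two
    rw [← integral_add (hint u) (hint v)]
    exact integral_congr_ae (ae_restrict_of_ae (Lp.coeFn_add (u : Lp ℝ 2 (volume : Measure (Space N))) v))
  map_smul' c u := by
    rw [RingHom.id_apply, smul_eq_mul, ← integral_const_mul]
    exact integral_congr_ae (ae_restrict_of_ae (Lp.coeFn_smul c (u : Lp ℝ 2 (volume : Measure (Space N)))))

/-- Up to finitely many linear conditions, the `L²` norm is arbitrarily small compared with the
norm of `X_K(Ω)`: this is the compactness of the embedding of `X_K(Ω)` into `L²`. -/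
theorem exists_linearMap_setIntegral_mul_self_le (hΩ : Bornology.IsBounded Ω) {ε : ℝ}
    (hε : 0 < ε) : ∃ (S : Finset (Fin N → ℤ)) (L : XK Ω hK →ₗ[ℝ] (S → ℝ)), ∀ u, L u = 0 →
      ∫ x in Ω, (u : Lp ℝ 2 volume) x * (u : Lp ℝ 2 volume) x ≤ ε * innerK u u := by
  obtain ⟨α, s, hα, hs, -, -, hlow⟩ := hK.lower_bound
  obtain ⟨δ, hδε, hδ⟩ : ∃ δ : ℝ,
      √N ^ ((N : ℝ) + 2 * s) / (2 * α) * δ ^ (2 * s) < ε ∧ 0 < δ := by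
    have hcont : Filter.Tendsto
        (fun δ : ℝ => √N ^ ((N : ℝ) + 2 * s) / (2 * α) * δ ^ (2 * s)) (𝓝[>] 0) (𝓝 0) := by
      have h := ((Real.continuousAt_rpow_const 0 (2 * s) (Or.inr (by linarith))).const_mul
        (√N ^ ((N : ℝ) + 2 * s) / (2 * α))).tendsto
      simp only [Real.zero_rpow (by linarith : 2 * s ≠ 0), mul_zero] at h
      exact h.mono_left nhdsWithin_le_nhds
    exact ((hcont.eventually_lt_const hε).and self_mem_nhdsWithin).exists
  obtain ⟨S, hS⟩ := exists_finset_subset_iUnion_cube hδ hΩ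
  refine ⟨S, LinearMap.pi fun k => setIntegralLinear hK (Q := cube N δ k)
    (by rw [volume_cube hδ]; exact ENNReal.ofReal_ne_top), fun u hu => ?_⟩
  refine (setIntegral_mul_self_le_of_cube_mean_eq_zero hα hs hlow hδ hS u
    fun k hk => congrFun hu ⟨k, hk⟩).trans ?_
  exact mul_le_mul_of_nonneg_right hδε.le (innerK_self_nonneg u)

end Inequalities

/-! ### Variational values as thresholds of domination -/

section Variational

open scoped Pointwise

variable {N : ℕ} {Ω : Set (Space N)} {K : Space N → ℝ} {hK : IsKernel K}

theorem innerK_smul_self (c : ℝ) (u : XK Ω hK) :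
    innerK (c • u) (c • u) = c ^ 2 * innerK u u := by
  rw [innerK_smul_left, innerK_comm, innerK_smul_left]
  ring

theorem weightForm_smul_self (ρ : Weight Ω) (c : ℝ) (u : XK Ω hK) :
    weightForm ρ (c • u) (c • u) = c ^ 2 * weightForm ρ u u := by
  rw [weightForm_smul_left, weightForm_comm, weightForm_smul_left]
  ring

theorem innerK_add_smul_self (u v : XK Ω hK) (c : ℝ) :
    innerK (v + c • u) (v + c • u) = innerK v v + 2 * c * innerK u v + c ^ 2 * innerK u u := by
  rw [innerK_add_left, innerK_comm v, innerK_comm (c • u) (v + c • u), innerK_add_left,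
    innerK_add_left, innerK_comm v (c • u), innerK_smul_self, innerK_smul_left]
  ring

theorem weightForm_add_smul_self (ρ : Weight Ω) (u v : XK Ω hK) (c : ℝ) :
    weightForm ρ (v + c • u) (v + c • u) =
      weightForm ρ v v + 2 * c * weightForm ρ u v + c ^ 2 * weightForm ρ u u := by
  rw [weightForm_add_left, weightForm_comm ρ v, weightForm_comm ρ (c • u) (v + c • u),
    weightForm_add_left, weightForm_add_left, weightForm_comm ρ v (c • u), weightForm_smul_self,
    weightForm_smul_left]
  ring

variable (hK) in
/-- On some `k`-dimensional subspace, `∫_Ω ρ v²` is bounded below by `c ‖v‖²`. -/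
def DominatesOnDim (ρ : Weight Ω) (c : ℝ) (k : ℕ) : Prop :=
  ∃ F : Submodule ℝ (XK Ω hK), Module.finrank ℝ F = k ∧
    ∀ v ∈ F, c * innerK v v ≤ weightForm ρ v v

theorem exists_weightForm_self_le (hΩm : MeasurableSet Ω) (hΩ : Bornology.IsBounded Ω) :
    ∃ C : ℝ, 0 < C ∧ ∀ (ρ : Weight Ω) (u : XK Ω hK),
      weightForm ρ u u ≤ C * ‖ρ‖ * innerK u u := by
  obtain ⟨C, hC, h⟩ := exists_poincare_const (hK := hK) hΩm hΩ
  refine ⟨C, hC, fun ρ u => (weightForm_self_le ρ u).trans ?_⟩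
  calc _ ≤ ‖ρ‖ * (C * innerK u u) := mul_le_mul_of_nonneg_left (h u) (norm_nonneg ρ)
    _ = _ := by ring

theorem bddBelow_rayleighValues (hΩm : MeasurableSet Ω) (hΩ : Bornology.IsBounded Ω)
    (ρ : Weight Ω) (F : Submodule ℝ (XK Ω hK)) : BddBelow (rayleighValues ρ F) := by
  obtain ⟨C, -, h⟩ := exists_weightForm_self_le (hK := hK) hΩm hΩ
  refine ⟨-(C * ‖ρ‖), ?_⟩
  rintro _ ⟨u, ⟨-, hu⟩, rfl⟩
  have := h (-ρ) u
  rw [weightForm_neg_weight, norm_neg, (normK_eq_one_iff u).1 hu] at this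
  simp only
  linarith

theorem rayleighValues_nonempty (hΩm : MeasurableSet Ω) (hΩ : Bornology.IsBounded Ω)
    (ρ : Weight Ω) {F : Submodule ℝ (XK Ω hK)} (hF : 0 < Module.finrank ℝ F) :
    (rayleighValues ρ F).Nonempty := by
  have : Nontrivial F := Module.nontrivial_of_finrank_pos hF
  obtain ⟨⟨u, huF⟩, hu⟩ := exists_ne (0 : F)
  have hpos := innerK_self_pos hΩm hΩ (u := u) fun h => hu (Subtype.ext h)
  refine ⟨_, (√(innerK u u))⁻¹ • u, ⟨F.smul_mem _ huF, ?_⟩, rfl⟩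
  rw [normK_eq_one_iff, innerK_smul_self, inv_pow, Real.sq_sqrt hpos.le, inv_mul_cancel₀ hpos.ne']

theorem sInf_rayleighValues_mul_le (hΩm : MeasurableSet Ω) (hΩ : Bornology.IsBounded Ω)
    (ρ : Weight Ω) {F : Submodule ℝ (XK Ω hK)} {v : XK Ω hK} (hv : v ∈ F) :
    sInf (rayleighValues ρ F) * innerK v v ≤ weightForm ρ v v := by
  by_cases h0 : v = 0
  · have h1 := innerK_smul_left (0 : ℝ) v v
    have h2 := weightForm_smul_left ρ (0 : ℝ) v v
    rw [zero_smul, zero_mul] at h1 h2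
    subst h0
    rw [h1, h2, mul_zero]
  have hpos := innerK_self_pos hΩm hΩ h0
  have hle : sInf (rayleighValues ρ F) ≤ weightForm ρ v v / innerK v v := by
    refine csInf_le (bddBelow_rayleighValues hΩm hΩ ρ F)
      ⟨(√(innerK v v))⁻¹ • v, ⟨F.smul_mem _ hv, ?_⟩, ?_⟩
    · rw [normK_eq_one_iff, innerK_smul_self, inv_pow, Real.sq_sqrt hpos.le,
        inv_mul_cancel₀ hpos.ne']
    · simp only [weightForm_smul_self]
      rw [inv_pow, Real.sq_sqrt hpos.le, div_eq_inv_mul]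
  rwa [le_div_iff₀ hpos] at hle

/-- `supInf` is the supremum of the constants by which the weighted form dominates the norm on
some `k`-dimensional subspace. -/
theorem isLUB_supInf (hΩm : MeasurableSet Ω) (hΩ : Bornology.IsBounded Ω) (ρ : Weight Ω)
    {k : ℕ} (hk : 0 < k) {c : ℝ} (hc : DominatesOnDim hK ρ c k) :
    IsLUB {c | DominatesOnDim hK ρ c k} (supInf hK ρ k) := by
  obtain ⟨C, -, hC⟩ := exists_weightForm_self_le (hK := hK) hΩm hΩ
  have hlub : IsLUB {t | ∃ F : Submodule ℝ (XK Ω hK), Module.finrank ℝ F = k ∧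
      t = sInf (rayleighValues ρ F)} (supInf hK ρ k) := by
    -- The hypothesis on `c` only supplies a `k`-dimensional subspace, without which `sSup` would be
    -- taken over the empty set.
    obtain ⟨F, hF, -⟩ := hc
    refine isLUB_csSup ⟨_, F, hF, rfl⟩ ⟨C * ‖ρ‖, ?_⟩
    rintro _ ⟨F, hF, rfl⟩
    obtain ⟨_, u, ⟨huF, hu⟩, rfl⟩ := rayleighValues_nonempty hΩm hΩ ρ (hF ▸ hk)
    refine (csInf_le (bddBelow_rayleighValues hΩm hΩ ρ F) ⟨u, ⟨huF, hu⟩, rfl⟩).trans ?_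
    have := hC ρ u
    rwa [(normK_eq_one_iff u).1 hu, mul_one] at this
  constructor
  · rintro d ⟨F, hF, hd⟩
    refine le_trans (le_csInf (rayleighValues_nonempty hΩm hΩ ρ (hF ▸ hk)) ?_)
      (hlub.1 ⟨F, hF, rfl⟩)
    rintro _ ⟨u, ⟨huF, hu⟩, rfl⟩
    have := hd u huF
    rwa [(normK_eq_one_iff u).1 hu, mul_one] at this
  · refine fun b hb => hlub.2 ?_
    rintro _ ⟨F, hF, rfl⟩
    exact hb ⟨F, hF, fun v hv => sInf_rayleighValues_mul_le hΩm hΩ ρ hv⟩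

/-- A subspace of dimension above the number of cubes contains a nonzero `v` with mean zero on each
cube. Its `L²` norm is then too small for `∫ ρ v² ≥ c ‖v‖²`. -/
theorem DominatesOnDim.exists_bound (hΩm : MeasurableSet Ω) (hΩ : Bornology.IsBounded Ω)
    (ρ : Weight Ω) {c : ℝ} (hc : 0 < c) :
    ∃ M : ℕ, ∀ k, DominatesOnDim hK ρ c k → k ≤ M := by
  have hρ : 0 < ‖ρ‖ + 1 := by positivity
  -- This choice of `ε` makes `‖ρ‖ ε < c`, also when `‖ρ‖ = 0`.
  obtain ⟨S, L, hL⟩ := exists_linearMap_setIntegral_mul_self_le (hK := hK) hΩ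
    (show 0 < c / (‖ρ‖ + 1) by positivity)
  refine ⟨S.card, ?_⟩
  rintro _ ⟨F, rfl, hF⟩
  by_contra! hlt
  have : Module.Finite ℝ F := Module.finite_of_finrank_pos (by omega)
  have hker : LinearMap.ker (L.comp F.subtype) ≠ ⊥ :=
    LinearMap.ker_ne_bot_of_finrank_lt (by simpa using hlt)
  obtain ⟨⟨v, hvF⟩, hv, hv0⟩ := Submodule.exists_mem_ne_zero_of_ne_bot hker
  have hpos := innerK_self_pos hΩm hΩ (u := v) fun h => hv0 (Subtype.ext h)
  have h1 := (hF v hvF).trans (weightForm_self_le ρ v)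
  have h2 := mul_le_mul_of_nonneg_left (hL v hv) (norm_nonneg ρ)
  have h3 : c * innerK v v ≤ ‖ρ‖ * (c / (‖ρ‖ + 1)) * innerK v v := by linarith
  have h4 := le_of_mul_le_mul_right h3 hpos
  rw [mul_div_assoc', le_div_iff₀ hρ] at h4
  linarith

/-- Adding an eigenfunction to a subspace on which the weighted form strictly dominates. -/
theorem DominatesOnDim.succ_of_lt (hΩm : MeasurableSet Ω) (hΩ : Bornology.IsBounded Ω)
    {ρ : Weight Ω} {c d : ℝ} {k : ℕ} (hk : 0 < k) (hd : DominatesOnDim hK ρ d k) (hcd : c < d)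
    {u : XK Ω hK} (hu0 : u ≠ 0) (hu : ∀ v, weightForm ρ u v = c * innerK u v) :
    DominatesOnDim hK ρ c (k + 1) := by
  obtain ⟨F, rfl, hF⟩ := hd
  have : Module.Finite ℝ F := Module.finite_of_finrank_pos hk
  have huF : u ∉ F := fun h => by
    have h1 := hF u h
    rw [hu u] at h1
    exact absurd (le_of_mul_le_mul_right h1 (innerK_self_pos hΩm hΩ hu0)) hcd.not_ge
  refine ⟨F ⊔ Submodule.span ℝ {u}, ?_, fun w hw => ?_⟩
  · have h1 := Submodule.finrank_sup_add_finrank_inf_eq F (Submodule.span ℝ {u})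
    have h2 : F ⊓ Submodule.span ℝ {u} = ⊥ :=
      disjoint_iff.1 ((Submodule.disjoint_span_singleton' hu0).2 huF)
    rwa [h2, finrank_bot, add_zero, finrank_span_singleton hu0] at h1
  · obtain ⟨v, hv, z, hz, rfl⟩ := Submodule.mem_sup.1 hw
    obtain ⟨b, rfl⟩ := Submodule.mem_span_singleton.1 hz
    -- On `v + b u` the cross terms and the `u` terms of the two forms agree up to the factor `c`,
    -- so only `c ‖v‖² ≤ ∫ ρ v²` remains.
    rw [innerK_add_smul_self, weightForm_add_smul_self, hu, hu]
    have h1 := hF v hv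
    have h2 := mul_le_mul_of_nonneg_right hcd.le (innerK_self_nonneg v)
    linarith

theorem DominatesOnDim.mono {ρ σ : Weight Ω} (h : ρ ≤ σ) {c : ℝ} {k : ℕ}
    (hc : DominatesOnDim hK ρ c k) : DominatesOnDim hK σ c k := by
  obtain ⟨F, hF, hc⟩ := hc
  refine ⟨F, hF, fun v hv => (hc v hv).trans ?_⟩
  have h1 := weightForm_add_weight ρ (σ - ρ) v v
  rw [add_sub_cancel] at h1
  linarith [weightForm_self_nonneg (hK := hK) (sub_nonneg.2 h) v]

/-- If `c` is attained by an eigenfunction and `k` is the largest dimension on which the weighted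
form dominates `c ‖·‖²`, then `c` is the `k`-th variational value. -/
theorem supInf_eq_of_not_dominatesOnDim_succ (hΩm : MeasurableSet Ω)
    (hΩ : Bornology.IsBounded Ω) {ρ : Weight Ω} {c : ℝ} {k : ℕ} (hk : 0 < k)
    {u : XK Ω hK} (hu0 : u ≠ 0) (hu : ∀ v, weightForm ρ u v = c * innerK u v)
    (hc : DominatesOnDim hK ρ c k) (hsucc : ¬ DominatesOnDim hK ρ c (k + 1)) :
    supInf hK ρ k = c := by
  have hlub := isLUB_supInf hΩm hΩ ρ hk hc
  refine le_antisymm (hlub.2 fun d hd => ?_) (hlub.1 hc)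
  by_contra! hcd
  exact hsucc (DominatesOnDim.succ_of_lt hΩm hΩ hk hd hcd hu0 hu)

theorem posPart_ne_zero_of_weightForm_pos {ρ : Weight Ω} {u : XK Ω hK}
    (h : 0 < weightForm ρ u u) : ρ⁺ ≠ 0 := by
  intro h0
  have h1 := weightForm_self_nonneg (hK := hK) (neg_nonneg.2 (posPart_eq_zero.1 h0)) u
  rw [weightForm_neg_weight] at h1
  linarith

/-! ### Perturbing the weight on the zero set of an eigenfunction -/

/-- A weight that is nonnegative, nontrivial and supported where `u` vanishes. -/
theorem exists_weight_supported_on_zeros (hΩm : MeasurableSet Ω) (hΩ : Bornology.IsBounded Ω)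
    (u : XK Ω hK) (hu : volume {x ∈ Ω | (u : Lp ℝ 2 volume) x = 0} ≠ 0) :
    ∃ χ : Weight Ω, 0 ≤ χ ∧ χ ≠ 0 ∧ ∀ v : XK Ω hK, weightForm χ u v = 0 := by
  set A : Set (Space N) := {x ∈ Ω | (u : Lp ℝ 2 volume) x = 0}
  have hA : MeasurableSet A := hΩm.inter
    ((Lp.stronglyMeasurable (u : Lp ℝ 2 (volume : Measure (Space N)))).measurable
      (measurableSet_singleton 0))
  have hAΩ : A ⊆ Ω := fun x hx => hx.1
  have hμA : volume.restrict Ω A = volume A := Measure.restrict_eq_self _ hAΩ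
  have hAfin : volume.restrict Ω A ≠ ∞ := by
    rw [hμA]
    exact ((hΩ.subset hAΩ).measure_lt_top).ne
  have hcoe := indicatorConstLp_coeFn (p := ∞) (hs := hA) (hμs := hAfin) (c := (1 : ℝ))
  refine ⟨indicatorConstLp ∞ hA hAfin (1 : ℝ), ?_, fun h0 => ?_, fun v => ?_⟩
  · refine (Lp.coeFn_nonneg _).1 ?_
    filter_upwards [hcoe] with x hx
    rw [hx]
    exact indicator_nonneg (fun _ _ => zero_le_one) x
  · rw [h0] at hcoe
    have h1 : A.indicator (fun _ => (1 : ℝ)) =ᵐ[volume.restrict Ω] 0 :=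
      hcoe.symm.trans (Lp.coeFn_zero ℝ ∞ (volume.restrict Ω))
    rw [indicator_ae_eq_zero] at h1
    have h2 : Function.support (fun _ : Space N => (1 : ℝ)) = univ := by
      ext x; simp
    rw [h2, inter_univ, hμA] at h1
    exact hu h1
  · refine integral_eq_zero_of_ae ?_
    filter_upwards [hcoe] with x hx
    rw [hx]
    by_cases hxA : x ∈ A
    · simp [hxA.2]
    · simp [hxA]

/-- If an eigenfunction with positive eigenvalue vanishes on a set of positive measure, some
variational value does not change when the weight is increased on that set. -/
theorem exists_supInf_eq_of_eigenfunction (hΩm : MeasurableSet Ω) (hΩ : Bornology.IsBounded Ω)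
    {ρ : Weight Ω} {l : ℝ} (hl : 0 < l) {u : XK Ω hK} (hu : IsEigenfunction ρ l u)
    (hzero : volume {x ∈ Ω | (u : Lp ℝ 2 volume) x = 0} ≠ 0) :
    ∃ ρ' : Weight Ω, ρ ≤ ρ' ∧ ρ ≠ ρ' ∧ ρ⁺ ≠ 0 ∧ ρ'⁺ ≠ 0 ∧
      ∃ k : ℕ, 0 < k ∧ supInf hK ρ k = supInf hK ρ' k := by
  obtain ⟨χ, hχ0, hχne, hχ⟩ := exists_weight_supported_on_zeros hΩm hΩ u hzero
  have hu0 : u ≠ 0 := hu.1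
  have hpos := innerK_self_pos hΩm hΩ hu0
  set c := l⁻¹ with hc_def
  have hc : 0 < c := inv_pos.2 hl
  have heig : ∀ (t : ℝ) (v : XK Ω hK), weightForm (ρ + t • χ) u v = c * innerK u v := by
    intro t v
    rw [weightForm_add_weight, weightForm_smul_weight, hχ, hu.2 v, hc_def]
    field_simp
    ring
  have heig0 : weightForm ρ u u = c * innerK u u := by simpa using heig 0 u
  have hone : ∀ t : ℝ, DominatesOnDim hK (ρ + t • χ) c 1 := by
    refine fun t => ⟨Submodule.span ℝ {u}, finrank_span_singleton hu0, fun v hv => ?_⟩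
    obtain ⟨b, rfl⟩ := Submodule.mem_span_singleton.1 hv
    rw [innerK_smul_self, weightForm_smul_self, heig]
    exact le_of_eq (by ring)
  obtain ⟨M, hM⟩ := DominatesOnDim.exists_bound (hK := hK) hΩm hΩ (ρ + (1 : ℝ) • χ) hc
  -- Otherwise induction from the line spanned by `u` would reach every dimension for every `t > 0`,
  -- against the bound `M` at `t = 1`. The value `t = 0` is left out: it is recovered as a limit.
  obtain ⟨k, hk, hall, t, ht, hsucc⟩ : ∃ k : ℕ, 0 < k ∧
      (∀ t : ℝ, 0 < t → DominatesOnDim hK (ρ + t • χ) c k) ∧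
      ∃ t : ℝ, 0 < t ∧ ¬ DominatesOnDim hK (ρ + t • χ) c (k + 1) := by
    by_contra! hcon
    have hind : ∀ k : ℕ, ∀ t : ℝ, 0 < t → DominatesOnDim hK (ρ + t • χ) c (k + 1) := by
      intro k
      induction k with
      | zero => exact fun t _ => hone t
      | succ k ih => exact hcon (k + 1) k.succ_pos ih
    exact absurd (hM _ (hind M 1 one_pos)) (by omega)
  have htχ : 0 ≤ t • χ := by
    refine (Lp.coeFn_nonneg _).1 ?_
    filter_upwards [Lp.coeFn_smul t χ, (Lp.coeFn_nonneg χ).2 hχ0] with x hx hx0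
    rw [hx]
    exact mul_nonneg ht.le hx0
  have hle : ρ ≤ ρ + t • χ := le_add_of_nonneg_right htχ
  refine ⟨ρ + t • χ, hle, fun h => ?_,
    posPart_ne_zero_of_weightForm_pos (u := u) (by rw [heig0]; positivity),
    posPart_ne_zero_of_weightForm_pos (u := u) (by rw [heig]; positivity), k, hk, ?_⟩
  · rw [left_eq_add, smul_eq_zero] at h
    exact h.elim ht.ne' hχne
  rw [supInf_eq_of_not_dominatesOnDim_succ hΩm hΩ hk hu0 (heig t) (hall t ht) hsucc]
  obtain ⟨C, hC0, hC⟩ := exists_weightForm_self_le (hK := hK) hΩm hΩ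
  -- A subspace good for `ρ + τ χ` is good for `ρ` up to the loss `τ ∫ χ v² ≤ τ C ‖χ‖ ‖v‖²`.
  have happrox : ∀ τ : ℝ, 0 < τ → DominatesOnDim hK ρ (c - τ * (C * ‖χ‖)) k := by
    intro τ hτ
    obtain ⟨F, hF, hdom⟩ := hall τ hτ
    refine ⟨F, hF, fun v hv => ?_⟩
    have h1 := hdom v hv
    rw [weightForm_add_weight, weightForm_smul_weight] at h1
    have h2 := mul_le_mul_of_nonneg_left (hC χ v) hτ.le
    linarith
  have hlub := isLUB_supInf hΩm hΩ ρ hk (happrox 1 one_pos)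
  refine le_antisymm (hlub.2 fun d hd => ?_) ?_
  · rw [← supInf_eq_of_not_dominatesOnDim_succ hΩm hΩ hk hu0 (heig t) (hall t ht) hsucc]
    exact (isLUB_supInf hΩm hΩ _ hk (hall t ht)).1 (DominatesOnDim.mono hle hd)
  · have hlim : Filter.Tendsto (fun τ : ℝ => c - τ * (C * ‖χ‖)) (𝓝[>] 0) (𝓝 c) := by
      have : ContinuousAt (fun τ : ℝ => c - τ * (C * ‖χ‖)) 0 := by fun_prop
      have h := this.tendsto
      simp only [zero_mul, sub_zero] at h
      exact h.mono_left nhdsWithin_le_nhds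
    refine le_of_tendsto hlim ?_
    filter_upwards [self_mem_nhdsWithin] with τ hτ
    exact hlub.1 (happrox τ hτ)

/-! ### Change of sign and conclusion -/

theorem rayleighValues_neg (ρ : Weight Ω) (F : Submodule ℝ (XK Ω hK)) :
    rayleighValues (-ρ) F = -rayleighValues ρ F := by
  simp only [rayleighValues, weightForm_neg_weight]
  rw [← Set.image_neg_eq_neg, Set.image_image]

/-- On the reals `sInf s = -sSup (-s)` is the definition, so the identity holds even where the
default values intervene. -/
theorem infSup_eq_neg_supInf_neg (ρ : Weight Ω) (k : ℕ) :
    infSup hK ρ k = -supInf hK (-ρ) k := by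
  rw [infSup, supInf, Real.sInf_def]
  congr 2
  ext t
  simp only [Set.mem_neg, mem_ofPred_eq, rayleighValues_neg, Real.sInf_def, neg_neg,
    neg_eq_iff_eq_neg]

theorem IsEigenfunction.neg_weight {ρ : Weight Ω} {l : ℝ} {u : XK Ω hK}
    (hu : IsEigenfunction ρ l u) : IsEigenfunction (-ρ) (-l) u :=
  ⟨hu.1, fun v => by rw [weightForm_neg_weight, neg_mul_neg, hu.2 v]⟩

end Variational

end NonlocalEig

end

theorem theorem3p3 {N : ℕ} (Ω : Set (NonlocalEig.Space N))
    (hΩ : NonlocalEig.IsLipschitzDomain Ω)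
    (K : NonlocalEig.Space N → ℝ) (hK : NonlocalEig.IsKernel K)
    (ρ : NonlocalEig.Weight Ω) (hρ : ρ ≠ 0) (hucp : ¬ NonlocalEig.HasUCP hK ρ) :
    ∃ ρ' : NonlocalEig.Weight Ω, ρ' ≠ 0 ∧ (ρ ≤ ρ' ∨ ρ' ≤ ρ) ∧ ρ ≠ ρ' ∧
      ∃ k : ℤ, k ≠ 0 ∧ NonlocalEig.Admissible ρ k ∧ NonlocalEig.Admissible ρ' k ∧
        NonlocalEig.eigenvalue hK ρ k = NonlocalEig.eigenvalue hK ρ' k := by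
  have hΩm := hΩ.isOpen.measurableSet
  simp only [NonlocalEig.HasUCP, not_forall] at hucp
  obtain ⟨l, u, hu, hzero⟩ := hucp
  rcases lt_trichotomy l 0 with hl | rfl | hl
  · obtain ⟨σ, hle, hne, hp, hp', k, hk, heq⟩ := NonlocalEig.exists_supInf_eq_of_eigenfunction hΩm
      hΩ.isBounded (neg_pos.2 hl) hu.neg_weight hzero
    rw [posPart_neg] at hp
    have hp'' : (-σ)⁻ ≠ 0 := by rwa [negPart_neg]
    refine ⟨-σ, fun h => hp'' (by rw [h, negPart_zero]), Or.inr (neg_le.1 hle),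
      fun h => hne (by rw [h, neg_neg]), -(k : ℤ), by omega, Or.inr ⟨by omega, hp⟩,
      Or.inr ⟨by omega, hp''⟩, ?_⟩
    rw [NonlocalEig.eigenvalue, NonlocalEig.eigenvalue, if_neg (by omega), if_neg (by omega), Int.natAbs_neg,
      Int.natAbs_natCast, NonlocalEig.infSup_eq_neg_supInf_neg,
      NonlocalEig.infSup_eq_neg_supInf_neg, neg_neg, heq]
  -- Eigenvalue `0` would give `u` zero energy.
  · have h1 := hu.2 u
    rw [zero_mul] at h1
    exact absurd h1 (NonlocalEig.innerK_self_pos hΩm hΩ.isBounded hu.1).ne'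
  · obtain ⟨σ, hle, hne, hp, hp', k, hk, heq⟩ := NonlocalEig.exists_supInf_eq_of_eigenfunction hΩm
      hΩ.isBounded hl hu hzero
    refine ⟨σ, fun h => hp' (by rw [h, posPart_zero]), Or.inl hle, hne, k, by omega,
      Or.inl ⟨by omega, hp⟩, Or.inl ⟨by omega, hp'⟩, ?_⟩
    rw [NonlocalEig.eigenvalue, NonlocalEig.eigenvalue, if_pos (by omega), if_pos (by omega),
      Int.natAbs_natCast, heq]
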